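/- Let $R$ be a complete discrete valuation ring with maximal ideal $P$ and quotient field $K$, and let $\Lambda=(P^{\alpha_{ij}})\subseteq M_n(K)$ be a tiled $R$-order, where $\alpha_{ij}$ are non-negative integers with $\alpha_{ii}=0$ and $\alpha_{ij}+\alpha_{jk}\ge\alpha_{ik}$ for all $i,j,k$; thus $\Lambda$ is the $R$-algebra of all matrices $x \in M_n(K)$ with $x_{ij}\in P^{\alpha_{ij}}$ for all $i,j$. Assume that $\Lambda$ is basic, i.e. that the left $\Lambda$-modules $\Lambda e_{11},\dots,\Lambda e_{nn}$ ($e_{ii}$ the diagonal matrix units) are pairwise non-isomorphic, and that it is a $(0,1)$-order, i.e. that $\alpha_{ij}\in\{0,1\}$ for all $i,j$. For $1\le k\le n$ let $M_k=\{x\in\Lambda : x_{kk}\in P\}$; since $\Lambda$ is basic, $M_1,\dots,M_n$ are its maximal two-sided ideals. The link graph $Q(\Lambda)$ is the quiver with vertices $1,\dots,n$ and an arrow from $i$ to $j$ (possibly $i=j$) if and only if $M_jM_i\ne M_j\cap M_i$. Let $\operatorname{Aut}(Q(\Lambda))$ be the group of permutations $\sigma$ of $\{1,\dots,n\}$ such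 that there is an arrow from $i$ to $j$ if and only if there is one from $\sigma(i)$ to $\sigma(j)$. Let $\operatorname{Aut}_R(\Lambda)$ be the group of $R$-algebra automorphisms of $\Lambda$ and $\operatorname{Inn}(\Lambda)$ its subgroup of conjugations by units of $\Lambda$. An automorphism $\varphi\in\operatorname{Aut}_R(\Lambda)$ induces $\sigma$ if $\varphi(M_i)=M_{\sigma(i)}$ for all $i$, and $\sigma\in\operatorname{Aut}(Q(\Lambda))$ is called liftable if it is induced by some $\varphi\in\operatorname{Aut}_R(\Lambda)$. Then every $\sigma\in\operatorname{Aut}(Q(\Lambda))$ is liftable. Consequently $\operatorname{Aut}_R(\Lambda)\cong\operatorname{Inn}(\Lambda)\rtimes\operatorname{Aut}(Q(\Lambda))$; more precisely, there is such an isomorphism, for some action of $\operatorname{Aut}(Q(\Lambda))$ on $\operatorname{Inn}(\Lambda)$, that restricts to the inclusion on $\operatorname{Inn}(\Lambda)$ and sends each $\sigma\in\operatorname{Aut}(Q(\Lambda))$ to an automorphism of $\Lambda$ that induces $\sigma$. -/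

import Mathlib

open scoped Matrix

/-- An exponent matrix: a matrix of non-negative integers `α i j` with `α i i = 0` and
`α i k ≤ α i j + α j k`. -/
structure ExponentMatrix (n : ℕ) where
  /-- The entries `α i j`. -/
  exp : Fin n → Fin n → ℕ
  diag : ∀ i, exp i i = 0
  triangle : ∀ i j k, exp i k ≤ exp i j + exp j k

namespace TiledOrder

section

variable (R K : Type*) [CommRing R] [IsDomain R] [IsDiscreteValuationRing R]
  [Field K] [Algebra R K]

/-- The `R`-submodule `P ^ a` of `K`, where `P` is the maximal ideal of `R`. -/
def primePow (a : ℕ) : Submodule R K :=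
  IsLocalization.coeSubmodule K (IsLocalRing.maximalIdeal R ^ a)

lemma primePow_anti {a b : ℕ} (h : a ≤ b) : primePow R K b ≤ primePow R K a :=
  Submodule.map_mono (Ideal.pow_le_pow_right h)

lemma mul_mem_primePow {a b : ℕ} {x y : K} (hx : x ∈ primePow R K a)
    (hy : y ∈ primePow R K b) : x * y ∈ primePow R K (a + b) := by
  unfold primePow at *
  rw [pow_add, IsLocalization.coeSubmodule_mul]
  exact Submodule.mul_mem_mul hx hy

lemma algebraMap_mem_primePow_zero (r : R) : algebraMap R K r ∈ primePow R K 0 := by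
  unfold primePow
  rw [IsLocalization.mem_coeSubmodule]
  exact ⟨r, by simp, rfl⟩

variable {n : ℕ} (α : ExponentMatrix n)

/-- The tiled `R`-order `Λ = (P ^ α i j)` in the matrix ring `M_n(K)`. -/
def order : Subalgebra R (Matrix (Fin n) (Fin n) K) where
  carrier := {x | ∀ i j, x i j ∈ primePow R K (α.exp i j)}
  mul_mem' := by
    intro x y hx hy i k
    rw [Matrix.mul_apply]
    exact Submodule.sum_mem _ fun j _ =>
      primePow_anti R K (α.triangle i j k) (mul_mem_primePow R K (hx i j) (hy j k))
  add_mem' := by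
    intro x y hx hy i j
    exact Submodule.add_mem _ (hx i j) (hy i j)
  algebraMap_mem' := by
    intro r i j
    rw [Matrix.algebraMap_matrix_apply]
    split_ifs with h
    · subst h
      rw [α.diag]
      exact algebraMap_mem_primePow_zero R K r
    · exact Submodule.zero_mem _

/-- The diagonal matrix unit `e i = e_{ii}`, as an element of `Λ`. -/
def idem (i : Fin n) : order R K α :=
  ⟨Matrix.single i i 1, by
    intro a b
    rw [Matrix.single_apply]
    split_ifs with h
    · obtain ⟨rfl, rfl⟩ := h
      rw [α.diag]
      simpa using algebraMap_mem_primePow_zero R K 1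
    · exact Submodule.zero_mem _⟩

/-- The `i`-th column `Λ e_i` of `Λ`, a projective left `Λ`-module. -/
def column (i : Fin n) : Submodule (order R K α) (order R K α) :=
  Submodule.span (order R K α) {idem R K α i}

/-- `Λ` is basic if its indecomposable projective modules `Λ e_1, …, Λ e_n` are pairwise
non-isomorphic. -/
def IsBasic : Prop :=
  ∀ i j : Fin n, i ≠ j →
    IsEmpty (column R K α i ≃ₗ[order R K α] column R K α j)

/-- The set `M_k ⊆ Λ` obtained from `Λ = (P ^ α i j)` by replacing the `R` in position `(k, k)`
by `P`. If `Λ` is basic, then `M_1, …, M_n` are its maximal two-sided ideals. -/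
def maxIdeal (k : Fin n) : Submodule R (order R K α) where
  carrier := {x | (x : Matrix (Fin n) (Fin n) K) k k ∈ primePow R K 1}
  add_mem' := fun hx hy => (primePow R K 1).add_mem hx hy
  zero_mem' := (primePow R K 1).zero_mem
  smul_mem' := fun r _ hx => (primePow R K 1).smul_mem r hx

/-- The link graph `Q(Λ)`: the vertices are `1, …, n`, and there is an arrow from `i` to `j` if and
only if `M_j M_i ≠ M_j ∩ M_i`. Loops are allowed. The product is the additive span of all products
of two elements. -/
def linkGraph : Digraph (Fin n) where
  Adj i j := maxIdeal R K α j * maxIdeal R K α i ≠ maxIdeal R K α j ⊓ maxIdeal R K α i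

/-- The group `Aut(Q(Λ))` of permutations of the vertices that preserve and reflect arrows;
the product is composition. -/
abbrev LinkGraphAut : Type :=
  (linkGraph R K α).Adj ≃r (linkGraph R K α).Adj

variable {R K α}

/-- The `R`-automorphism `φ` of `Λ` induces the permutation `σ` of the vertices of the link graph:
`φ(M_i) = M_{σ(i)}` for all `i`. -/
def Induces (φ : order R K α ≃ₐ[R] order R K α) (σ : Equiv.Perm (Fin n)) : Prop :=
  ∀ i, (maxIdeal R K α i).map φ.toLinearMap = maxIdeal R K α (σ i)

/-- An automorphism of the link graph is liftable if it is induced by an `R`-automorphism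
of `Λ`. -/
def IsLiftable (σ : LinkGraphAut R K α) : Prop :=
  ∃ φ : order R K α ≃ₐ[R] order R K α, Induces φ σ.toEquiv

end

/-- The group `Inn(A)` of inner automorphisms `x ↦ u x u⁻¹`, `u ∈ Aˣ`, of an `R`-algebra `A`,
as a subgroup of the group of `R`-algebra automorphisms of `A`. -/
def inner (R A : Type*) [CommRing R] [Ring A] [Algebra R A] : Subgroup (A ≃ₐ[R] A) where
  carrier := {φ | ∃ u : Aˣ, ∀ x, φ x = u * x * (u⁻¹ : Aˣ)}
  mul_mem' := by
    rintro φ ψ ⟨u, hu⟩ ⟨v, hv⟩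
    exact ⟨u * v, fun x => by simp [AlgEquiv.mul_apply, hu, hv, mul_assoc]⟩
  one_mem' := ⟨1, fun x => by simp⟩
  inv_mem' := by
    rintro φ ⟨u, hu⟩
    refine ⟨u⁻¹, fun x => φ.injective ?_⟩
    rw [hu (_ * _ * _)]
    have h : φ (φ⁻¹ x) = x := φ.apply_symm_apply x
    rw [h]
    simp [mul_assoc]

end TiledOrder

/-! For a basic `(0,1)`-order the relation `α i j = 0` is a partial order on the indices, and the
link graph is its Hasse diagram directed downwards, with an extra arrow from each minimal to each
maximal element (`linkGraph_adj_iff`, `isLink_iff_of_exp`). A symmetry `σ` of this graph either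
preserves the order or rotates it: some lower set D lies entirely below its complement, `σ` is an
order embedding on D and on the complement, and the image of the complement lies below the image of
D. In both cases `α (σ i) (σ j) = α i j + d i - d j`, where `d` is zero or the indicator of D
(`exists_potential_of_isLink_iff`). Conjugation by the monomial matrix with entries `p ^ d k` at `(σ
k, k)` then preserves Λ and lifts `σ` (`twist`). These conjugations depend on `σ` alone and compose
correctly, so they form a homomorphism (`linkGraphAutLift`).

Conversely, the `M_k` are the only completely prime ideals containing P, so every automorphism
permutes them (`exists_induces`), compatibly with arrows (`Induces.adj_iff`). If the permutation is
trivial, the automorphism is inner (`mem_inner_of_induces_one`). Hence the lifts split the extension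
of `Aut(Q(Λ))` by `Inn(Λ)`. -/

set_option linter.unusedSectionVars false

/-! ### Symmetries of the link relation of a finite poset. -/

section LinkRelation

variable {V W : Type*} [PartialOrder V] [PartialOrder W]

/-- The arrows of the link graph of the `(0,1)`-order attached to a finite poset: the arrows of the
Hasse diagram, directed downwards, and one arrow from each minimal to each maximal element. -/
def IsLink (x y : V) : Prop := y ⋖ x ∨ (IsMax y ∧ IsMin x)

lemma isLink_iff_isMin {x t : V} (ht : IsMax t) : IsLink x t ↔ IsMin x :=
  ⟨fun h => h.elim (fun h => (ht.not_lt h.lt).elim) And.right, fun h => Or.inr ⟨ht, h⟩⟩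

lemma isLink_iff_isMax {s y : V} (hs : IsMin s) : IsLink s y ↔ IsMax y :=
  ⟨fun h => h.elim (fun h => (hs.not_lt h.lt).elim) And.left, fun h => Or.inr ⟨h, hs⟩⟩

/-- A finite order is generated by its covers. Only covers inside the interval are tested, since `σ`
may reverse others; the target is any preorder so that `Prop` is allowed. -/
lemma map_le_of_covBy_map_le [Finite V] {β : Type*} [Preorder β] {f : V → β} {x y : V}
    (hxy : x ≤ y) (h : ∀ a b, x ≤ a → a ⋖ b → b ≤ y → f a ≤ f b) : f x ≤ f y := by
  classical
  have := Fintype.ofFinite V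
  let : LocallyFiniteOrder V := Fintype.toLocallyFiniteOrder
  have key : ∀ c, Relation.ReflTransGen (· ⋖ ·) x c → c ≤ y → f x ≤ f c := by
    intro c hc
    induction hc with
    | refl => exact fun _ => le_rfl
    | tail hb hbc ih =>
      exact fun hcy => (ih (hbc.le.trans hcy)).trans
        (h _ _ (le_iff_reflTransGen_covBy.2 hb) hbc hcy)
  exact key y (le_iff_reflTransGen_covBy.1 hxy) le_rfl

lemma exists_isMax_ge [Finite V] (x : V) : ∃ t, IsMax t ∧ x ≤ t := by
  obtain ⟨t, hxt, ht⟩ := Set.finite_univ.exists_le_maximal (Set.mem_univ x)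
  exact ⟨t, fun b hb => ht.2 trivial hb, hxt⟩

lemma exists_isMin_le [Finite V] (x : V) : ∃ s, IsMin s ∧ s ≤ x := by
  obtain ⟨t, hxt, ht⟩ := Set.finite_univ.exists_le_minimal (Set.mem_univ x)
  exact ⟨t, fun b hb => ht.2 trivial hb, hxt⟩

/-- The lower set generated by the preimages of the maximal elements. -/
def lowerPart (σ : V ≃ W) : Set V := {v | ∃ t, IsMax (σ t) ∧ v ≤ t}

variable {σ : V ≃ W}

lemma isLink_symm (hσ : ∀ x y, IsLink x y ↔ IsLink (σ x) (σ y)) (x y : W) :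
    IsLink x y ↔ IsLink (σ.symm x) (σ.symm y) := by
  simp [hσ]

lemma covBy_map (hσ : ∀ x y, IsLink x y ↔ IsLink (σ x) (σ y)) {a b : V} (h : b ⋖ a)
    (hn : ¬ (IsMax (σ b) ∧ IsMin (σ a))) : σ b ⋖ σ a :=
  ((hσ a b).1 (Or.inl h)).resolve_right hn

/-- The arrows into a maximal element start exactly at the minimal elements, so one maximal element
with maximal image settles all minimal ones. -/
lemma isMin_map_iff (hσ : ∀ x y, IsLink x y ↔ IsLink (σ x) (σ y)) {t : V}
    (ht : IsMax t) (ht' : IsMax (σ t)) (x : V) : IsMin x ↔ IsMin (σ x) := by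
  rw [← isLink_iff_isMin ht, hσ, isLink_iff_isMin ht']

lemma isMax_map_iff (hσ : ∀ x y, IsLink x y ↔ IsLink (σ x) (σ y)) {s : V}
    (hs : IsMin s) (hs' : IsMin (σ s)) (x : V) : IsMax x ↔ IsMax (σ x) := by
  rw [← isLink_iff_isMax hs, hσ, isLink_iff_isMax hs']

/-- If minimal and maximal elements correspond to each other then `σ` is monotone. -/
lemma map_le_of_isMax_map_iff [Finite V] (hσ : ∀ x y, IsLink x y ↔ IsLink (σ x) (σ y))
    (hmax : ∀ x, IsMax x ↔ IsMax (σ x)) {x y : V} (h : x ≤ y) : σ x ≤ σ y :=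
  map_le_of_covBy_map_le h fun a _ _ hab _ =>
    (covBy_map hσ hab fun hn => ((hmax a).2 hn.1).not_lt hab.lt).le

/-- The extra arrow from `s` to `t` cannot remain an extra arrow, so it becomes a cover: the ends of
the poset are glued together. -/
lemma map_covBy_of_isMin_of_isMax (hσ : ∀ x y, IsLink x y ↔ IsLink (σ x) (σ y))
    (hmax : ∀ x, IsMax x → ¬ IsMax (σ x)) {s t : V} (hs : IsMin s) (ht : IsMax t) :
    σ t ⋖ σ s :=
  ((hσ s t).1 (Or.inr ⟨ht, hs⟩)).resolve_right fun h => hmax t ht h.1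

lemma isMax_symm_disjoint (hmax : ∀ x, IsMax x → ¬ IsMax (σ x)) (x : W) (hx : IsMax x) :
    ¬ IsMax (σ.symm x) := fun h => hmax _ h (by simpa using hx)

/-- A cover above `x` is lost only if its lower end has maximal image, which would put `x` in the
lower part. -/
lemma map_le_of_notMem_lowerPart [Finite V] (hσ : ∀ x y, IsLink x y ↔ IsLink (σ x) (σ y))
    {x y : V} (hx : x ∉ lowerPart σ) (h : x ≤ y) : σ x ≤ σ y :=
  map_le_of_covBy_map_le h fun a _ hxa hab _ =>
    (covBy_map hσ hab fun hn => hx ⟨a, hn.1, hxa⟩).le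

/-- Otherwise no cover on a chain from a minimal `s` through `v` to a maximal `t` is lost, giving `σ
s ≤ σ t`, against `σ t ⋖ σ s`. -/
lemma exists_isMin_map_le [Finite V] (hσ : ∀ x y, IsLink x y ↔ IsLink (σ x) (σ y))
    (hmax : ∀ x, IsMax x → ¬ IsMax (σ x)) {v : V} (hv : v ∉ lowerPart σ) :
    ∃ s, IsMin (σ s) ∧ s ≤ v := by
  by_contra! hn
  obtain ⟨s, hs, hsv⟩ := exists_isMin_le v
  obtain ⟨t, ht, hvt⟩ := exists_isMax_ge v
  have h1 : σ s ≤ σ v := map_le_of_covBy_map_le hsv fun a b _ hab hb =>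
    (covBy_map hσ hab fun h => hn b h.2 hb).le
  have h2 : σ v ≤ σ t := map_le_of_notMem_lowerPart hσ hv hvt
  exact (map_covBy_of_isMin_of_isMax hσ hmax hs ht).lt.not_ge (h1.trans h2)

lemma isMin_map_covBy (hσ : ∀ x y, IsLink x y ↔ IsLink (σ x) (σ y))
    (hmax : ∀ x, IsMax x → ¬ IsMax (σ x)) {s t : V} (hs : IsMin (σ s)) (ht : IsMax (σ t)) :
    t ⋖ s := by
  simpa using map_covBy_of_isMin_of_isMax (isLink_symm hσ) (isMax_symm_disjoint hmax) hs ht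

lemma le_of_mem_lowerPart_of_notMem [Finite V] (hσ : ∀ x y, IsLink x y ↔ IsLink (σ x) (σ y))
    (hmax : ∀ x, IsMax x → ¬ IsMax (σ x)) {i j : V} (hi : i ∈ lowerPart σ)
    (hj : j ∉ lowerPart σ) : i ≤ j := by
  obtain ⟨t, ht, hit⟩ := hi
  obtain ⟨s, hs, hsj⟩ := exists_isMin_map_le hσ hmax hj
  exact hit.trans ((isMin_map_covBy hσ hmax hs ht).le.trans hsj)

lemma not_le_of_notMem_lowerPart_of_mem {i j : V} (hi : i ∉ lowerPart σ)
    (hj : j ∈ lowerPart σ) : ¬ i ≤ j := by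
  obtain ⟨t, ht, hjt⟩ := hj
  exact fun h => hi ⟨t, ht, h.trans hjt⟩

/-- A lost cover below `j` would have an upper end with minimal image; that end would cover `t`, yet
it lies below `j ≤ t`. -/
lemma map_le_of_mem_lowerPart [Finite V] (hσ : ∀ x y, IsLink x y ↔ IsLink (σ x) (σ y))
    (hmax : ∀ x, IsMax x → ¬ IsMax (σ x)) {i j : V} (hj : j ∈ lowerPart σ) (h : i ≤ j) :
    σ i ≤ σ j := by
  obtain ⟨t, ht, hjt⟩ := hj
  exact map_le_of_covBy_map_le h fun a b _ hab hbj => (covBy_map hσ hab fun hn =>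
    (isMin_map_covBy hσ hmax hn.2 ht).lt.not_ge (hbj.trans hjt)).le

/-- This exchange of parts lets the monotonicity lemmas for `σ.symm` supply the converse
implications for `σ`. -/
lemma mem_lowerPart_iff [Finite V] [Finite W] (hσ : ∀ x y, IsLink x y ↔ IsLink (σ x) (σ y))
    (hmax : ∀ x, IsMax x → ¬ IsMax (σ x)) (v : V) :
    v ∈ lowerPart σ ↔ σ v ∉ lowerPart σ.symm := by
  constructor
  · rintro hv ⟨t, ht, hvt⟩
    have ht' : σ.symm t ∉ lowerPart σ := by
      rintro ⟨t', ht', h⟩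
      exact hmax t' (fun b hb => (ht (h.trans hb)).trans h) ht'
    refine ht' ?_
    -- On `Prop` the order is implication, so membership is pushed upwards cover by cover.
    have key : (σ.symm (σ v) ∈ lowerPart σ) ≤ (σ.symm t ∈ lowerPart σ) := by
      refine map_le_of_covBy_map_le (f := fun w => (σ.symm w ∈ lowerPart σ)) hvt ?_
      intro b a _ hba _ hb
      by_contra ha
      obtain ⟨t', ht', hbt⟩ := hb
      obtain ⟨s', hs', hsa⟩ := exists_isMin_map_le hσ hmax ha
      -- Here `σ.symm b ≤ t' < s' ≤ σ.symm a`. A cover forces `t' = σ.symm b`, making `b` maximal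
      -- despite `b < a`; an extra arrow forces the same equality, against `hmax`.
      have hst := isMin_map_covBy hσ hmax hs' ht'
      rcases (isLink_symm hσ a b).1 (Or.inl hba) with hc | ⟨hb', -⟩
      · have h1 : t' = σ.symm b :=
          (hc.eq_or_eq hbt (hst.le.trans hsa)).resolve_right
            (hst.lt.trans_le hsa).ne
        rw [h1, Equiv.apply_symm_apply] at ht'
        exact ht'.not_lt hba.lt
      · obtain rfl := hb'.eq_of_le hbt
        exact hmax _ hb' ht'
    exact key (by simpa using hv)
  · intro hv
    by_contra h
    obtain ⟨t, ht, hvt⟩ := exists_isMax_ge v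
    exact hv ⟨σ t, by simpa using ht, map_le_of_notMem_lowerPart hσ h hvt⟩

open Classical in
/-- A bijection of finite posets that preserves the link relation changes the order relation
by a coboundary. -/
theorem exists_potential_of_isLink_iff [Finite V] [Finite W] (σ : V ≃ W)
    (hσ : ∀ x y, IsLink x y ↔ IsLink (σ x) (σ y)) :
    ∃ d : V → ℤ, ∀ i j, (if σ i ≤ σ j then 0 else 1 : ℤ) =
      (if i ≤ j then 0 else 1 : ℤ) + d i - d j := by
  by_cases hmax : ∀ x, IsMax x → ¬ IsMax (σ x)
  -- Within each part the order survives; between the parts it is reversed, which `d i - d j = ±1`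
  -- records.
  · refine ⟨fun v => if v ∈ lowerPart σ then 1 else 0, fun i j => ?_⟩
    have hσ' := isLink_symm hσ
    have hmax' := isMax_symm_disjoint hmax
    have hD := mem_lowerPart_iff hσ hmax
    by_cases hi : i ∈ lowerPart σ <;> by_cases hj : j ∈ lowerPart σ
    · have h : σ i ≤ σ j ↔ i ≤ j :=
        ⟨fun h => by simpa using map_le_of_notMem_lowerPart hσ' ((hD i).1 hi) h,
          map_le_of_mem_lowerPart hσ hmax hj⟩
      simp [hi, hj, h]
    · have h1 := le_of_mem_lowerPart_of_notMem hσ hmax hi hj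
      have h2 := not_le_of_notMem_lowerPart_of_mem ((hD i).1 hi) (not_not.1 (mt (hD j).2 hj))
      simp [hi, hj, h1, h2]
    · have h1 := not_le_of_notMem_lowerPart_of_mem hi hj
      have h2 := le_of_mem_lowerPart_of_notMem hσ' hmax' (not_not.1 (mt (hD i).2 hi)) ((hD j).1 hj)
      simp [hi, hj, h1, h2]
    · have h : σ i ≤ σ j ↔ i ≤ j :=
        ⟨fun h => by
          simpa using map_le_of_mem_lowerPart hσ' hmax' (not_not.1 (mt (hD j).2 hj)) h,
          map_le_of_notMem_lowerPart hσ hi⟩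
      simp [hi, hj, h]
  -- One maximal element with maximal image makes `σ` preserve minimal, then maximal elements, then
  -- the order; no correction is needed.
  · push Not at hmax
    obtain ⟨t, ht, ht'⟩ := hmax
    obtain ⟨s, hs, -⟩ := exists_isMin_le t
    have hmax := isMax_map_iff hσ hs ((isMin_map_iff hσ ht ht' s).1 hs)
    refine ⟨0, fun i j => ?_⟩
    have h : σ i ≤ σ j ↔ i ≤ j :=
      ⟨fun h => by
        simpa using map_le_of_isMax_map_iff (isLink_symm hσ) (by simp [hmax]) h,
        map_le_of_isMax_map_iff hσ hmax⟩
    simp [h]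

end LinkRelation

/-! ### Split extensions and inner automorphisms. -/

lemma exists_semidirectProduct_mulEquiv {G Q : Type*} [Group G] [Group Q] (N : Subgroup G)
    [N.Normal] (s : Q →* G) (hinj : ∀ q, s q ∈ N → q = 1)
    (hsurj : ∀ g, ∃ q, g * (s q)⁻¹ ∈ N) :
    ∃ (θ : Q →* MulAut N) (e : N ⋊[θ] Q ≃* G),
      (∀ u : N, e (SemidirectProduct.inl u) = u) ∧
        ∀ q : Q, e (SemidirectProduct.inr q) = s q := by
  -- The hypotheses make the image of `s` a complement of `N`, so `G` is an internal semidirect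
  -- product with `Q` acting by conjugation.
  let θ : Q →* MulAut N := MulAut.conjNormal.comp s
  let f : N ⋊[θ] Q →* G := SemidirectProduct.lift N.subtype s fun q => by
    ext u
    simp [θ]
  have hf : Function.Bijective f := by
    constructor
    · rw [injective_iff_map_eq_one]
      rintro ⟨u, q⟩ h
      have h' : (u : G) * s q = 1 := h
      have hq : q = 1 := hinj q (by
        rw [eq_inv_of_mul_eq_one_right h']
        exact N.inv_mem u.2)
      subst hq
      ext
      · simpa using h'
      · rfl
    · intro g
      obtain ⟨q, hq⟩ := hsurj g
      refine ⟨⟨⟨_, hq⟩, q⟩, ?_⟩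
      change g * (s q)⁻¹ * s q = g
      simp
  refine ⟨θ, MulEquiv.ofBijective f hf, fun u => ?_, fun q => ?_⟩
  · simp [f]
  · simp [f]

namespace TiledOrder

section InnerNormal

variable {R A : Type*} [CommRing R] [Ring A] [Algebra R A]

instance inner_normal : (inner R A).Normal where
  conj_mem := by
    rintro φ ⟨u, hu⟩ ψ
    refine ⟨Units.map (ψ : A →* A) u, fun x => ?_⟩
    simp [AlgEquiv.mul_apply, hu]

/-- Conjugation by a unit, as an algebra automorphism. -/
def conjAlgEquiv (u : Aˣ) : A ≃ₐ[R] A :=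
  AlgEquiv.ofAlgHom
    (AlgHom.ofLinearMap ((LinearMap.mulRight R (↑u⁻¹ : A)).comp (LinearMap.mulLeft R (u : A)))
      (by simp) (by simp [mul_assoc]))
    (AlgHom.ofLinearMap ((LinearMap.mulRight R (u : A)).comp (LinearMap.mulLeft R (↑u⁻¹ : A)))
      (by simp) (by simp [mul_assoc]))
    (by ext; simp [mul_assoc]) (by ext; simp [mul_assoc])

lemma conjAlgEquiv_apply (u : Aˣ) (x : A) :
    conjAlgEquiv (R := R) u x = u * x * (u⁻¹ : Aˣ) := rfl

lemma conjAlgEquiv_mem_inner (u : Aˣ) : conjAlgEquiv (R := R) u ∈ inner R A :=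
  ⟨u, fun _ => rfl⟩

end InnerNormal

/-! ### Powers of the maximal ideal inside `K`. -/

section PrimePow

variable {R K : Type*} [CommRing R] [IsDomain R] [IsDiscreteValuationRing R]
  [Field K] [Algebra R K]

lemma mem_primePow_iff {p : R} (hp : Irreducible p) {a : ℕ} {x : K} :
    x ∈ primePow R K a ↔ ∃ r, x = algebraMap R K p ^ a * algebraMap R K r := by
  unfold primePow
  rw [IsLocalization.mem_coeSubmodule, hp.maximalIdeal_eq, Ideal.span_singleton_pow]
  constructor
  · rintro ⟨y, hy, rfl⟩
    obtain ⟨r, rfl⟩ := Ideal.mem_span_singleton.1 hy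
    exact ⟨r, by simp⟩
  · rintro ⟨r, rfl⟩
    exact ⟨p ^ a * r, Ideal.mem_span_singleton.2 ⟨r, rfl⟩, by simp⟩

lemma mem_primePow_zero {x : K} : x ∈ primePow R K 0 ↔ ∃ r, algebraMap R K r = x := by
  unfold primePow
  simp

lemma mem_primePow_zero_of_mem {a : ℕ} {x : K} (hx : x ∈ primePow R K a) :
    x ∈ primePow R K 0 := primePow_anti R K (Nat.zero_le a) hx

variable [IsFractionRing R K]

lemma algebraMap_mem_primePow_one {r : R} :
    algebraMap R K r ∈ primePow R K 1 ↔ r ∈ IsLocalRing.maximalIdeal R := by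
  unfold primePow
  rw [pow_one, IsLocalization.mem_coeSubmodule]
  constructor
  · rintro ⟨y, hy, h⟩
    rwa [← IsFractionRing.injective R K h]
  · exact fun h => ⟨r, h, rfl⟩

lemma one_notMem_primePow_one : (1 : K) ∉ primePow R K 1 := by
  rw [← map_one (algebraMap R K), algebraMap_mem_primePow_one]
  exact (Ideal.ne_top_iff_one _).1 (IsLocalRing.maximalIdeal.isMaximal R).ne_top

lemma mem_or_mem_primePow_one {x y : K} (hx : x ∈ primePow R K 0) (hy : y ∈ primePow R K 0)
    (h : x * y ∈ primePow R K 1) : x ∈ primePow R K 1 ∨ y ∈ primePow R K 1 := by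
  obtain ⟨r, rfl⟩ := mem_primePow_zero.1 hx
  obtain ⟨s, rfl⟩ := mem_primePow_zero.1 hy
  rw [← map_mul, algebraMap_mem_primePow_one] at h
  simpa only [algebraMap_mem_primePow_one] using Ideal.IsPrime.mem_or_mem inferInstance h

lemma uniformizer_ne_zero {p : R} (hp : Irreducible p) : algebraMap R K p ≠ 0 := by
  simpa using hp.ne_zero

lemma uniformizer_pow_mem {p : R} (hp : Irreducible p) (a : ℕ) :
    algebraMap R K p ^ a ∈ primePow R K a := (mem_primePow_iff hp).2 ⟨1, by simp⟩

lemma uniformizer_pow_notMem {p : R} (hp : Irreducible p) (a : ℕ) :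
    algebraMap R K p ^ a ∉ primePow R K (a + 1) := by
  rw [mem_primePow_iff hp]
  rintro ⟨r, hr⟩
  have h0 := pow_ne_zero a (uniformizer_ne_zero (K := K) hp)
  rw [pow_succ, mul_assoc, eq_comm, mul_eq_left₀ h0] at hr
  refine one_notMem_primePow_one (R := R) (K := K) ((mem_primePow_iff hp).2 ⟨r, ?_⟩)
  rw [pow_one, hr]

lemma zpow_mul_mem_primePow {p : R} (hp : Irreducible p) {a b : ℕ} {x : K}
    (hx : x ∈ primePow R K a) :
    algebraMap R K p ^ ((b : ℤ) - a) * x ∈ primePow R K b := by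
  obtain ⟨r, rfl⟩ := (mem_primePow_iff hp).1 hx
  refine (mem_primePow_iff hp).2 ⟨r, ?_⟩
  rw [← mul_assoc, ← zpow_natCast, ← zpow_natCast, ← zpow_add₀ (uniformizer_ne_zero hp)]
  simp

end PrimePow

/-! ### Matrix units and Peirce components of Λ. -/

section Entries

variable {R K : Type*} [CommRing R] [IsDomain R] [IsDiscreteValuationRing R]
  [Field K] [Algebra R K] {n : ℕ} {α : ExponentMatrix n}

lemma entry_mem (x : order R K α) (i j : Fin n) :
    (x : Matrix (Fin n) (Fin n) K) i j ∈ primePow R K (α.exp i j) := x.2 i j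

/-- The element of the order with entry `c` at position `(i, j)` and zeros elsewhere. -/
def entry (i j : Fin n) (c : K) (hc : c ∈ primePow R K (α.exp i j)) : order R K α :=
  ⟨Matrix.single i j c, by
    intro a b
    rw [Matrix.single_apply]
    split_ifs with h
    · obtain ⟨rfl, rfl⟩ := h
      exact hc
    · exact Submodule.zero_mem _⟩

lemma coe_entry (i j : Fin n) (c : K) (hc : c ∈ primePow R K (α.exp i j)) :
    (entry i j c hc : Matrix (Fin n) (Fin n) K) = Matrix.single i j c := rfl

lemma coe_idem (i : Fin n) :
    (idem R K α i : Matrix (Fin n) (Fin n) K) = Matrix.single i i 1 := rfl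

lemma sum_idem : ∑ i, idem R K α i = 1 := by
  apply Subtype.ext
  rw [AddSubmonoidClass.coe_finsetSum]
  simp only [coe_idem]
  ext a b
  rw [Matrix.sum_apply]
  by_cases h : a = b
  · subst h
    simp [Matrix.single_apply]
  · simp only [Matrix.single_apply, OneMemClass.coe_one, Matrix.one_apply_ne h]
    exact Finset.sum_eq_zero fun c _ => if_neg fun h' => h (h'.1.symm.trans h'.2)

lemma idem_mul_idem_self (i : Fin n) : idem R K α i * idem R K α i = idem R K α i := by
  apply Subtype.ext
  simp [coe_idem]

lemma idem_mul_idem {i j : Fin n} (h : i ≠ j) : idem R K α i * idem R K α j = 0 := by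
  apply Subtype.ext
  simp [coe_idem, h]

lemma idem_mul_mul_idem (x : order R K α) (i j : Fin n) :
    idem R K α i * x * idem R K α j =
      entry i j ((x : Matrix (Fin n) (Fin n) K) i j) (entry_mem x i j) := by
  apply Subtype.ext
  simp [coe_idem, coe_entry]

lemma entry_apply_same (i j : Fin n) (c : K) (hc : c ∈ primePow R K (α.exp i j)) :
    (entry i j c hc : Matrix (Fin n) (Fin n) K) i j = c := by
  simp [coe_entry]

lemma entry_mul_entry (i j k : Fin n) (c d : K) (hc : c ∈ primePow R K (α.exp i j))
    (hd : d ∈ primePow R K (α.exp j k)) :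
    entry i j c hc * entry j k d hd = entry i k (c * d)
      (primePow_anti R K (α.triangle i j k) (mul_mem_primePow R K hc hd)) := by
  apply Subtype.ext
  simp [coe_entry]

lemma entry_congr {i j : Fin n} {c d : K} (h : c = d) (hc : c ∈ primePow R K (α.exp i j)) :
    entry i j c hc = entry i j d (h ▸ hc) := by
  subst h
  rfl

lemma entry_one_self (i : Fin n) (h : (1 : K) ∈ primePow R K (α.exp i i)) :
    entry i i 1 h = idem R K α i := rfl

lemma mem_column {i : Fin n} {x : order R K α} :
    x ∈ column R K α i ↔ x * idem R K α i = x := by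
  unfold column
  rw [Submodule.mem_span_singleton]
  constructor
  · rintro ⟨y, rfl⟩
    rw [smul_eq_mul, mul_assoc, idem_mul_idem_self]
  · exact fun h => ⟨x, h⟩

/-- In a basic tiled order the exponents at positions `(i, j)` and `(j, i)` do not both vanish. -/
lemma IsBasic.exp_add_exp_pos (h : IsBasic R K α) {i j : Fin n} (hij : i ≠ j) :
    0 < α.exp i j + α.exp j i := by
  by_contra h0
  have h1 : α.exp i j = 0 := by omega
  have h2 : α.exp j i = 0 := by omega
  have hone : (1 : K) ∈ primePow R K 0 := by
    simpa using algebraMap_mem_primePow_zero R K 1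
  have ha : (1 : K) ∈ primePow R K (α.exp i j) := h1 ▸ hone
  have hb : (1 : K) ∈ primePow R K (α.exp j i) := h2 ▸ hone
  have hab : entry (α := α) i j 1 ha * entry j i 1 hb = idem R K α i := by
    rw [entry_mul_entry, entry_congr (mul_one 1), entry_one_self]
  have hba : entry (α := α) j i 1 hb * entry i j 1 ha = idem R K α j := by
    rw [entry_mul_entry, entry_congr (mul_one 1), entry_one_self]
  have haj : entry (α := α) i j 1 ha * idem R K α j = entry i j 1 ha := by
    rw [← entry_one_self j (by rw [α.diag]; exact hone), entry_mul_entry,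
      entry_congr (mul_one 1)]
  have hbi : entry (α := α) j i 1 hb * idem R K α i = entry j i 1 hb := by
    rw [← entry_one_self i (by rw [α.diag]; exact hone), entry_mul_entry,
      entry_congr (mul_one 1)]
  -- Right multiplications by the matrix units at `(i, j)` and `(j, i)` are inverse isomorphisms
  -- between the two columns.
  refine (h i j hij).elim' (LinearEquiv.ofLinearMap
    (((LinearMap.toSpanSingleton _ _ (entry (α := α) i j 1 ha)).comp
      (column R K α i).subtype).codRestrict _ fun x => ?_)
    (((LinearMap.toSpanSingleton _ _ (entry (α := α) j i 1 hb)).comp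
      (column R K α j).subtype).codRestrict _ fun x => ?_) ?_ ?_)
  · rw [mem_column]
    simp [mul_assoc, haj]
  · rw [mem_column]
    simp [mul_assoc, hbi]
  · ext1 x
    apply Subtype.ext
    simpa [mul_assoc, hba] using mem_column.1 x.2
  · ext1 x
    apply Subtype.ext
    simpa [mul_assoc, hab] using mem_column.1 x.2

end Entries

end TiledOrder

namespace TiledOrder

/-! ### Completely prime ideals and the permutation induced by an automorphism. -/

section CompletelyPrime

variable {R A B : Type*} [CommRing R] [IsLocalRing R] [Ring A] [Algebra R A] [Ring B] [Algebra R B]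

/-- A completely prime two-sided ideal that contains the maximal ideal of the base ring. -/
structure IsCompletelyPrime (I : Submodule R A) : Prop where
  mul_left : ∀ x y, y ∈ I → x * y ∈ I
  mul_right : ∀ x y, x ∈ I → x * y ∈ I
  one_notMem : (1 : A) ∉ I
  mem_or_mem : ∀ x y, x * y ∈ I → x ∈ I ∨ y ∈ I
  smul_one_mem : ∀ r ∈ IsLocalRing.maximalIdeal R, r • (1 : A) ∈ I

lemma mem_map_algEquiv {φ : A ≃ₐ[R] B} {I : Submodule R A} {y : B} :
    y ∈ I.map φ.toLinearMap ↔ φ.symm y ∈ I := by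
  constructor
  · rintro ⟨x, hx, rfl⟩
    simpa using hx
  · exact fun h => ⟨_, h, by simp⟩

lemma IsCompletelyPrime.map {I : Submodule R A} (h : IsCompletelyPrime I) (φ : A ≃ₐ[R] B) :
    IsCompletelyPrime (I.map φ.toLinearMap) where
  mul_left x y hy := by
    rw [mem_map_algEquiv] at *
    simpa using h.mul_left _ _ hy
  mul_right x y hy := by
    rw [mem_map_algEquiv] at *
    simpa using h.mul_right _ _ hy
  one_notMem := by
    rw [mem_map_algEquiv]
    simpa using h.one_notMem
  mem_or_mem x y hxy := by
    rw [mem_map_algEquiv] at *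
    rw [mem_map_algEquiv]
    exact h.mem_or_mem _ _ (by simpa using hxy)
  smul_one_mem r hr := by
    rw [mem_map_algEquiv]
    simpa using h.smul_one_mem r hr

end CompletelyPrime

variable {R K : Type*} [CommRing R] [IsDomain R] [IsDiscreteValuationRing R]
  [Field K] [Algebra R K] [IsFractionRing R K] {n : ℕ} {α : ExponentMatrix n}

section MaxIdeal

lemma mem_maxIdeal {k : Fin n} {x : order R K α} :
    x ∈ maxIdeal R K α k ↔ (x : Matrix (Fin n) (Fin n) K) k k ∈ primePow R K 1 := Iff.rfl

lemma idem_mem_maxIdeal_iff {i k : Fin n} : idem R K α i ∈ maxIdeal R K α k ↔ i ≠ k := by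
  rw [mem_maxIdeal, coe_idem]
  by_cases h : i = k
  · subst h
    simpa using one_notMem_primePow_one
  · simp [h]

/-- Paths from `k` to `k` through another index have positive exponent, so `x ↦ x k k` is
multiplicative modulo P and `M_k` is the kernel of a map to the residue field. -/
lemma mul_apply_self_sub_mem (hα : ∀ i j, i ≠ j → 0 < α.exp i j + α.exp j i)
    (x y : order R K α) (k : Fin n) :
    ((x * y : order R K α) : Matrix (Fin n) (Fin n) K) k k -
      (x : Matrix (Fin n) (Fin n) K) k k * (y : Matrix (Fin n) (Fin n) K) k k ∈
        primePow R K 1 := by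
  rw [MulMemClass.coe_mul, Matrix.mul_apply,
    ← Finset.add_sum_erase _ _ (Finset.mem_univ k), add_sub_cancel_left]
  exact Submodule.sum_mem _ fun j hj => primePow_anti R K
    (hα k j (Finset.ne_of_mem_erase hj).symm) (mul_mem_primePow R K (entry_mem x k j)
      (entry_mem y j k))

lemma entry_self_mem (x : order R K α) (i : Fin n) :
    (x : Matrix (Fin n) (Fin n) K) i i ∈ primePow R K 0 := by
  simpa only [α.diag] using entry_mem x i i

lemma coe_smul_one (r : R) : ((r • (1 : order R K α) : order R K α) : Matrix (Fin n) (Fin n) K) =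
    r • (1 : Matrix (Fin n) (Fin n) K) := rfl

lemma isCompletelyPrime_maxIdeal (hα : ∀ i j, i ≠ j → 0 < α.exp i j + α.exp j i) (k : Fin n) :
    IsCompletelyPrime (maxIdeal R K α k) where
  mul_left x y hy := by
    rw [mem_maxIdeal] at *
    rw [← Submodule.sub_mem_iff_left _ (by
      simpa using mul_mem_primePow R K (entry_self_mem x k) hy)]
    exact mul_apply_self_sub_mem hα x y k
  mul_right x y hx := by
    rw [mem_maxIdeal] at *
    rw [← Submodule.sub_mem_iff_left _ (by
      simpa using mul_mem_primePow R K hx (entry_self_mem y k))]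
    exact mul_apply_self_sub_mem hα x y k
  one_notMem := by
    rw [mem_maxIdeal]
    simpa using one_notMem_primePow_one
  mem_or_mem x y hxy := by
    rw [mem_maxIdeal] at *
    refine mem_or_mem_primePow_one (entry_self_mem x k) (entry_self_mem y k) ?_
    simpa using Submodule.sub_mem _ hxy (mul_apply_self_sub_mem hα x y k)
  smul_one_mem r hr := by
    rw [mem_maxIdeal, coe_smul_one, Matrix.smul_apply, Matrix.one_apply_eq, Algebra.smul_def,
      mul_one, algebraMap_mem_primePow_one]
    exact hr

/-- The ideals `M_k` are the only completely prime ideals of `Λ` that contain `P`. -/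
lemma IsCompletelyPrime.exists_eq_maxIdeal {I : Submodule R (order R K α)}
    (hI : IsCompletelyPrime I) : ∃ j, I = maxIdeal R K α j := by
  have hex : ∃ j, idem R K α j ∉ I := by
    by_contra! h
    exact hI.one_notMem (sum_idem (R := R) (K := K) (α := α) ▸ Submodule.sum_mem _ fun i _ => h i)
  obtain ⟨j, hj⟩ := hex
  refine ⟨j, Submodule.ext fun x => ?_⟩
  -- Since `e_j ∉ I`, orthogonality puts every other idempotent in `I`, and primeness lets the
  -- corner `e_j x e_j` decide whether `x ∈ I`.
  have hne : ∀ i, i ≠ j → idem R K α i ∈ I := fun i hi =>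
    (hI.mem_or_mem _ _ (by rw [idem_mul_idem hi]; exact I.zero_mem)).resolve_right hj
  obtain ⟨r, hr⟩ := mem_primePow_zero.1 (entry_self_mem x j)
  have hx : x ∈ I ↔ idem R K α j * x * idem R K α j ∈ I :=
    ⟨fun h => hI.mul_right _ _ (hI.mul_left _ _ h), fun h =>
      ((hI.mem_or_mem _ _ ((hI.mem_or_mem _ _ h).resolve_right hj))).resolve_left hj⟩
  have hx' : idem R K α j * x * idem R K α j = (r • 1) * idem R K α j := by
    apply Subtype.ext
    rw [idem_mul_mul_idem, coe_entry, MulMemClass.coe_mul, coe_smul_one, coe_idem, smul_one_mul,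
      Matrix.smul_single, Algebra.smul_def, mul_one, hr]
  rw [hx, hx', mem_maxIdeal, ← hr, algebraMap_mem_primePow_one]
  constructor
  · intro h
    by_contra hnot
    have hu : IsUnit r := by simpa using hnot
    obtain ⟨s, hs⟩ := hu.exists_left_inv
    apply hj
    have := I.smul_mem s h
    rwa [smul_one_mul, smul_smul, hs, one_smul] at this
  · exact fun h => hI.mul_right _ _ (hI.smul_one_mem r h)

lemma maxIdeal_injective : Function.Injective (maxIdeal R K α) := by
  intro i j h
  by_contra hij
  exact idem_mem_maxIdeal_iff.1 (h ▸ idem_mem_maxIdeal_iff.2 hij :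
    idem R K α i ∈ maxIdeal R K α i) rfl

lemma map_injective_algEquiv (φ : order R K α ≃ₐ[R] order R K α) :
    Function.Injective (Submodule.map φ.toLinearMap) :=
  Submodule.map_injective_of_injective φ.injective

/-- Every automorphism permutes the ideals `M_k`. -/
lemma exists_induces (hα : ∀ i j, i ≠ j → 0 < α.exp i j + α.exp j i)
    (φ : order R K α ≃ₐ[R] order R K α) : ∃ σ : Equiv.Perm (Fin n), Induces φ σ := by
  choose f hf using fun i => ((isCompletelyPrime_maxIdeal (R := R) (K := K) hα i).map
    φ).exists_eq_maxIdeal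
  have hinj : Function.Injective f := fun i j hij =>
    maxIdeal_injective (map_injective_algEquiv φ (by rw [hf, hf, hij]))
  exact ⟨Equiv.ofBijective f (Finite.injective_iff_bijective.1 hinj), hf⟩

/-- Inclusions suffice: the ideals are already permuted, and the idempotents show that no `M_k`
contains a different one. -/
lemma induces_of_mem (hα : ∀ i j, i ≠ j → 0 < α.exp i j + α.exp j i)
    {φ : order R K α ≃ₐ[R] order R K α} {σ : Equiv.Perm (Fin n)}
    (h : ∀ i, ∀ x ∈ maxIdeal R K α i, φ x ∈ maxIdeal R K α (σ i)) : Induces φ σ := by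
  obtain ⟨τ, hτ⟩ := exists_induces hα φ
  suffices τ = σ from this ▸ hτ
  ext1 i
  by_contra hne
  have h1 : idem R K α (σ i) ∈ maxIdeal R K α (τ i) := idem_mem_maxIdeal_iff.2 (Ne.symm hne)
  rw [← hτ i] at h1
  obtain ⟨x, hx, hx'⟩ := h1
  exact idem_mem_maxIdeal_iff.1 (hx' ▸ h i x hx : idem R K α (σ i) ∈ _) rfl

lemma Induces.mul {φ ψ : order R K α ≃ₐ[R] order R K α} {σ τ : Equiv.Perm (Fin n)}
    (hφ : Induces φ σ) (hψ : Induces ψ τ) : Induces (φ * ψ) (σ * τ) := by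
  intro i
  rw [Equiv.Perm.mul_apply, ← hφ, ← hψ, ← Submodule.map_comp]
  rfl

lemma Induces.inv {φ : order R K α ≃ₐ[R] order R K α} {σ : Equiv.Perm (Fin n)}
    (hφ : Induces φ σ) : Induces φ⁻¹ σ⁻¹ := by
  intro i
  apply map_injective_algEquiv φ
  rw [hφ, show σ (σ⁻¹ i) = i from σ.apply_symm_apply i, ← Submodule.map_comp]
  convert Submodule.map_id _
  ext1 x
  exact φ.apply_symm_apply x

lemma Induces.unique {φ : order R K α ≃ₐ[R] order R K α} {σ τ : Equiv.Perm (Fin n)}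
    (h : Induces φ σ) (h' : Induces φ τ) : σ = τ :=
  Equiv.ext fun i => maxIdeal_injective ((h i).symm.trans (h' i))

lemma induces_one_of_mem_inner (hα : ∀ i j, i ≠ j → 0 < α.exp i j + α.exp j i)
    {φ : order R K α ≃ₐ[R] order R K α} (hφ : φ ∈ inner R (order R K α)) : Induces φ 1 := by
  obtain ⟨u, hu⟩ := hφ
  refine induces_of_mem hα fun i x hx => ?_
  have h := isCompletelyPrime_maxIdeal (R := R) (K := K) hα i
  rw [hu]
  exact h.mul_right _ _ (h.mul_left _ _ hx)

lemma Induces.adj_iff {φ : order R K α ≃ₐ[R] order R K α} {σ : Equiv.Perm (Fin n)}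
    (h : Induces φ σ) (i j : Fin n) :
    (linkGraph R K α).Adj (σ i) (σ j) ↔ (linkGraph R K α).Adj i j := by
  change maxIdeal R K α (σ j) * maxIdeal R K α (σ i) ≠
    maxIdeal R K α (σ j) ⊓ maxIdeal R K α (σ i) ↔
    maxIdeal R K α j * maxIdeal R K α i ≠ maxIdeal R K α j ⊓ maxIdeal R K α i
  have hmul := Submodule.map_mul (maxIdeal R K α j) (maxIdeal R K α i) φ.toAlgHom
  have hinf := Submodule.map_inf φ.toLinearMap (p := maxIdeal R K α j) (q := maxIdeal R K α i)
    φ.injective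
  rw [← h i, ← h j, ← hinf]
  refine not_congr ⟨fun h' => map_injective_algEquiv φ (Eq.trans hmul h'), fun h' => ?_⟩
  exact hmul.symm.trans (congrArg (Submodule.map φ.toLinearMap) h')

end MaxIdeal

/-! ### From the link graph to exponents and the poset. -/

section LinkGraph

/-- The link graph of a tiled order in terms of its exponents. -/
lemma linkGraph_adj_iff (hα : ∀ i j, i ≠ j → 0 < α.exp i j + α.exp j i) (i j : Fin n) :
    (linkGraph R K α).Adj i j ↔
      ∀ c, c ≠ i → c ≠ j → (if i = j then 1 else α.exp j i) < α.exp j c + α.exp c i := by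
  obtain ⟨p, hp⟩ := IsDiscreteValuationRing.exists_irreducible R
  -- The `(j, i)` entries of `M_j ∩ M_i` fill exactly `P ^ m`; on the diagonal the exponent rises
  -- from 0 to 1.
  set m := if i = j then 1 else α.exp j i with hm
  have hji : α.exp j i ≤ m := by
    rw [hm]
    split_ifs with h
    · rw [h, α.diag]
      exact Nat.zero_le _
    · exact le_rfl
  have hPi := isCompletelyPrime_maxIdeal (R := R) (K := K) hα i
  have hPj := isCompletelyPrime_maxIdeal (R := R) (K := K) hα j
  change maxIdeal R K α j * maxIdeal R K α i ≠ maxIdeal R K α j ⊓ maxIdeal R K α i ↔ _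
  constructor
  · intro h
    by_contra! hc
    obtain ⟨c, hci, hcj, hc⟩ := hc
    refine h (le_antisymm (Submodule.mul_le.2 fun x hx y hy =>
      ⟨hPj.mul_right _ _ hx, hPi.mul_left _ _ hy⟩) ?_)
    rintro x ⟨hxj, hxi⟩
    -- As `e_a ∈ M_j` for `a ≠ j` and `e_b ∈ M_i` for `b ≠ i`, only the Peirce component at `(j, i)`
    -- is in doubt; it factors through `c`.
    rw [← one_mul x, ← sum_idem, Finset.sum_mul]
    refine Submodule.sum_mem _ fun a _ => ?_
    by_cases ha : a = j
    swap
    · exact Submodule.mul_mem_mul (idem_mem_maxIdeal_iff.2 ha) hxi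
    subst ha
    rw [← mul_one (_ * x), ← sum_idem, Finset.mul_sum]
    refine Submodule.sum_mem _ fun b _ => ?_
    by_cases hb : b = i
    swap
    · exact Submodule.mul_mem_mul (hPj.mul_left _ _ hxj) (idem_mem_maxIdeal_iff.2 hb)
    subst hb
    have hx : (x : Matrix (Fin n) (Fin n) K) a b ∈
        primePow R K (α.exp a c + α.exp c b) := by
      refine primePow_anti R K hc ?_
      rw [hm]
      split_ifs with hab
      · subst hab
        exact hxj
      · exact entry_mem x a b
    obtain ⟨r, hr⟩ := (mem_primePow_iff hp).1 hx
    have h1 : algebraMap R K p ^ α.exp a c * algebraMap R K r ∈ primePow R K (α.exp a c) :=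
      (mem_primePow_iff hp).2 ⟨r, rfl⟩
    have h2 := uniformizer_pow_mem (K := K) hp (α.exp c b)
    have h3 : idem R K α a * x * idem R K α b = entry a c _ h1 * entry c b _ h2 := by
      rw [idem_mul_mul_idem, entry_mul_entry]
      apply entry_congr
      rw [hr]
      ring
    rw [h3]
    refine Submodule.mul_mem_mul ?_ ?_
    · rw [mem_maxIdeal, coe_entry]
      simp [hcj]
    · rw [mem_maxIdeal, coe_entry]
      simp [hci]
  · intro hc heq
    have hz := uniformizer_pow_mem (K := K) hp m
    have hmem : entry (α := α) j i _ (primePow_anti R K hji hz) ∈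
        maxIdeal R K α j ⊓ maxIdeal R K α i := by
      rw [Submodule.mem_inf, mem_maxIdeal, mem_maxIdeal, coe_entry]
      by_cases hij : i = j
      · subst hij
        simp only [Matrix.single_apply_same, and_self]
        simpa [hm] using hz
      · simp [hij, Ne.symm hij]
    rw [← heq] at hmem
    -- Every summand of a `(j, i)` entry gains a factor from P: through `j` or `i` from a diagonal
    -- entry, through other `c` from `hc`. Hence `p ^ m` is not reached.
    have hle : ∀ z ∈ maxIdeal R K α j * maxIdeal R K α i,
        (z : Matrix (Fin n) (Fin n) K) j i ∈ primePow R K (m + 1) := by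
      intro z hz
      induction hz using Submodule.mul_induction_on' with
      | add x _ y _ hx hy => exact Submodule.add_mem _ hx hy
      | mem_mul_mem x hx y hy =>
        rw [MulMemClass.coe_mul, Matrix.mul_apply]
        refine Submodule.sum_mem _ fun c _ => ?_
        rw [mem_maxIdeal] at hx hy
        by_cases hcj : c = j
        · subst hcj
          by_cases hij : i = c
          · subst hij
            simpa [hm] using mul_mem_primePow R K hx hy
          · rw [hm, if_neg hij, add_comm]
            exact mul_mem_primePow R K hx (entry_mem y c i)
        · by_cases hci : c = i
          · subst hci
            rw [hm, if_neg hcj]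
            exact mul_mem_primePow R K (entry_mem x j c) hy
          · exact primePow_anti R K (hc c hci hcj)
              (mul_mem_primePow R K (entry_mem x j c) (entry_mem y c i))
    have := hle _ hmem
    rw [entry_apply_same] at this
    exact uniformizer_pow_notMem hp m this

/-- The partial order on the indices in which `i ≤ j` if the exponent at `(i, j)` vanishes. -/
abbrev exponentOrder (hα : ∀ i j, i ≠ j → 0 < α.exp i j + α.exp j i) : PartialOrder (Fin n) where
  le i j := α.exp i j = 0
  lt i j := α.exp i j = 0 ∧ ¬ α.exp j i = 0
  lt_iff_le_not_ge _ _ := Iff.rfl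
  le_refl := α.diag
  le_trans i j k hij hjk := by
    have := α.triangle i j k
    omega
  le_antisymm i j hij hji := by
    by_contra h
    have := hα i j h
    omega

/-- The link relation of a finite poset in terms of the complement `e` of the order relation. -/
lemma isLink_iff_of_exp {V : Type*} [PartialOrder V] [DecidableEq V] (e : V → V → ℕ)
    (hle : ∀ a b, a ≤ b ↔ e a b = 0) (h01 : ∀ a b, e a b = 0 ∨ e a b = 1) (i j : V) :
    (∀ c, c ≠ i → c ≠ j → (if i = j then 1 else e j i) < e j c + e c i) ↔ IsLink i j := by
  have hlt : ∀ a b : V, a < b ↔ e a b = 0 ∧ a ≠ b := fun a b => by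
    rw [lt_iff_le_and_ne, hle]
  have hcov : ∀ a b : V, a ⋖ b ↔ a < b ∧ ∀ ⦃c⦄, a < c → ¬ c < b := fun _ _ => Iff.rfl
  have hmax : IsMax j ↔ ∀ c, c ≠ j → e j c = 1 := by
    constructor
    · intro h c hc
      refine (h01 j c).resolve_left fun h0 => hc ?_
      exact le_antisymm (h ((hle _ _).2 h0)) ((hle _ _).2 h0)
    · intro h c hc
      by_cases hcj : c = j
      · exact hcj.le
      · have := h c hcj
        rw [hle] at hc
        omega
  have hmin : IsMin i ↔ ∀ c, c ≠ i → e c i = 1 := by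
    constructor
    · intro h c hc
      refine (h01 c i).resolve_left fun h0 => hc ?_
      exact le_antisymm ((hle _ _).2 h0) (h ((hle _ _).2 h0))
    · intro h c hc
      by_cases hci : c = i
      · exact hci.ge
      · have := h c hci
        rw [hle] at hc
        omega
  unfold IsLink
  rw [hmax, hmin]
  by_cases hij : i = j
  · subst hij
    simp only [if_true]
    constructor
    · intro h
      refine Or.inr ⟨fun c hc => ?_, fun c hc => ?_⟩
      · have := h c hc hc
        have := h01 i c
        have := h01 c i
        omega
      · have := h c hc hc
        have := h01 i c
        have := h01 c i
        omega
    · rintro (h | ⟨h1, h2⟩) c hc -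
      · exact (lt_irrefl _ h.lt).elim
      · rw [h1 c hc, h2 c hc]
        omega
  · rw [if_neg hij]
    -- Exponent 0 means `j < i`, and the inequalities say that nothing lies between. Exponent 1
    -- forces both summands to be 1, so `j` is maximal and `i` minimal.
    rcases h01 j i with h0 | h1
    · rw [h0]
      constructor
      · intro h
        refine Or.inl ((hcov _ _).2 ⟨(hlt _ _).2 ⟨h0, Ne.symm hij⟩, fun c hjc hci => ?_⟩)
        rw [hlt] at hjc hci
        have := h c hci.2 hjc.2.symm
        omega
      · rintro (h | ⟨h1, h2⟩) c hci hcj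
        · by_contra hc
          refine ((hcov _ _).1 h).2 ((hlt j c).2 ⟨?_, Ne.symm hcj⟩) ((hlt c i).2 ⟨?_, hci⟩) <;>
            omega
        · rw [h1 c hcj]
          omega
    · rw [h1]
      constructor
      · intro h
        refine Or.inr ⟨fun c hc => ?_, fun c hc => ?_⟩
        · by_cases hci : c = i
          · rw [hci, h1]
          · have := h c hci hc
            have := h01 j c
            have := h01 c i
            omega
        · by_cases hcj : c = j
          · rw [hcj, h1]
          · have := h c hc hcj
            have := h01 j c
            have := h01 c i
            omega
      · rintro (h | ⟨h1', h2⟩) c hci hcj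
        · have := ((hlt _ _).1 h.lt).1
          omega
        · rw [h1' c hcj, h2 c hci]
          omega

/-- An abstract `V` keeps the exponent order apart from the usual order on `Fin n`. -/
lemma exists_potential_of_exp {V : Type*} [PartialOrder V] [Finite V] [DecidableEq V]
    (e : V → V → ℕ) (hle : ∀ a b, a ≤ b ↔ e a b = 0) (h01 : ∀ a b, e a b = 0 ∨ e a b = 1)
    (σ : Equiv.Perm V)
    (hσ : ∀ i j, (∀ c, c ≠ i → c ≠ j → (if i = j then 1 else e j i) < e j c + e c i) ↔
      ∀ c, c ≠ σ i → c ≠ σ j →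
        (if σ i = σ j then 1 else e (σ j) (σ i)) < e (σ j) c + e c (σ i)) :
    ∃ d : V → ℤ, ∀ i j, (e (σ i) (σ j) : ℤ) = e i j + d i - d j := by
  simp only [isLink_iff_of_exp e hle h01] at hσ
  obtain ⟨d, hd⟩ := exists_potential_of_isLink_iff σ hσ
  have he : ∀ a b, (e a b : ℤ) = if e a b = 0 then 0 else 1 := fun a b => by
    rcases h01 a b with h | h <;> simp [h]
  refine ⟨d, fun i j => ?_⟩
  have := hd i j
  simp only [hle] at this
  rw [he, he i j, this]

/-- An automorphism of the link graph of a basic `(0,1)`-order changes the exponent matrix by a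
coboundary. -/
lemma exists_potential (hα : ∀ i j, i ≠ j → 0 < α.exp i j + α.exp j i)
    (h01 : ∀ i j, α.exp i j = 0 ∨ α.exp i j = 1) (σ : LinkGraphAut R K α) :
    ∃ d : Fin n → ℤ, ∀ i j, (α.exp (σ i) (σ j) : ℤ) = α.exp i j + d i - d j := by
  refine @exists_potential_of_exp (Fin n) (exponentOrder hα) _ _ α.exp (fun _ _ => Iff.rfl) h01
    σ.toEquiv fun i j => ?_
  rw [← linkGraph_adj_iff (R := R) (K := K) hα, ← linkGraph_adj_iff (R := R) (K := K) hα]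
  exact σ.map_rel_iff.symm

end LinkGraph

end TiledOrder

namespace TiledOrder

variable {R K : Type*} [CommRing R] [IsDomain R] [IsDiscreteValuationRing R]
  [Field K] [Algebra R K] [IsFractionRing R K] {n : ℕ} {α : ExponentMatrix n}

/-! ### Units of Λ. -/

section Units

/-- A permutation that moves no element upwards in a finite poset is trivial. -/
lemma perm_eq_one_of_le {V : Type*} [PartialOrder V] [Finite V] (σ : Equiv.Perm V)
    (h : ∀ i, σ i ≤ i) : σ = 1 := by
  ext1 i
  induction i using (Finite.to_wellFoundedLT (α := V)).induction with
  | ind i ih =>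
    by_contra hne
    exact hne (σ.injective (ih _ (lt_of_le_of_ne (h i) hne)))

/-- An element of a subalgebra of a matrix algebra over `K` that is given by a matrix over `R` with
invertible determinant has its inverse in the subalgebra. -/
lemma isUnit_of_isUnit_det {m : Type*} [Fintype m] [DecidableEq m] {A : Type*} [Ring A]
    [Algebra R A] (f : A →ₐ[R] Matrix m m K) (hf : Function.Injective f) (x : A)
    (U : Matrix m m R) (hU : f x = U.map (algebraMap R K)) (hdet : IsUnit U.det) : IsUnit x := by
  -- By Cayley–Hamilton, with constant coefficient `± det U` a unit, the inverse is a polynomial in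
  -- `x` and so stays in the subalgebra.
  have h0 : Polynomial.aeval x U.charpoly = 0 := by
    apply hf
    rw [map_zero, ← Polynomial.aeval_algHom_apply, hU]
    have := congrArg (Algebra.ofId R K).mapMatrix U.aeval_self_charpoly
    rwa [← Polynomial.aeval_algHom_apply, map_zero] at this
  have hc : IsUnit (U.charpoly.coeff 0) := by
    rw [Matrix.det_eq_sign_charpoly_coeff] at hdet
    exact isUnit_of_mul_isUnit_right hdet
  obtain ⟨c, hc⟩ := hc
  rw [← Polynomial.divX_mul_X_add U.charpoly, ← hc] at h0
  set q := Polynomial.aeval x U.charpoly.divX with hq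
  have h1 : q * x = - algebraMap R A c := by
    rw [map_add, map_mul, Polynomial.aeval_X, Polynomial.aeval_C] at h0
    exact eq_neg_of_add_eq_zero_left h0
  have hcomm : x * q = q * x := by
    have := congrArg (Polynomial.aeval x) (mul_comm Polynomial.X U.charpoly.divX)
    simpa only [map_mul, Polynomial.aeval_X] using this
  have hu : IsUnit (x * q) := by
    rw [hcomm, h1]
    exact (c.isUnit.map (algebraMap R A)).neg
  exact ((Commute.isUnit_mul_iff hcomm).1 hu).1

/-- An element of a basic tiled order that lies in none of the ideals `M_k` is a unit. -/
lemma isUnit_of_notMem_maxIdeal (hα : ∀ i j, i ≠ j → 0 < α.exp i j + α.exp j i)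
    (x : order R K α) (hx : ∀ k, x ∉ maxIdeal R K α k) : IsUnit x := by
  choose U hU using fun i j => mem_primePow_zero.1 (mem_primePow_zero_of_mem (entry_mem x i j))
  refine isUnit_of_isUnit_det (order R K α).val Subtype.val_injective x (Matrix.of U)
    (Matrix.ext fun i j => (hU i j).symm) ?_
  have hpos : ∀ i j, α.exp i j ≠ 0 → IsLocalRing.residue R (U i j) = 0 := by
    intro i j h
    rw [IsLocalRing.residue_eq_zero_iff, ← algebraMap_mem_primePow_one (K := K), hU]
    exact primePow_anti R K (Nat.one_le_iff_ne_zero.2 h) (entry_mem x i j)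
  rw [← IsLocalRing.residue_ne_zero_iff_isUnit, RingHom.map_det, Matrix.det_apply,
    Finset.sum_eq_single 1]
  · simp only [Equiv.Perm.sign_one, one_smul]
    refine Finset.prod_ne_zero_iff.2 fun i _ => ?_
    have := hx i
    rw [mem_maxIdeal, ← hU, algebraMap_mem_primePow_one] at this
    simpa [IsLocalRing.residue_eq_zero_iff] using this
  -- Modulo P the matrix is triangular for the exponent order: a nonzero Leibniz term needs `σ i ≤
  -- i` throughout, so only the identity contributes.
  · intro σ _ hσ
    have : ∃ i, α.exp (σ i) i ≠ 0 := by
      by_contra! h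
      exact hσ (@perm_eq_one_of_le (Fin n) (exponentOrder hα) _ σ h)
    obtain ⟨i, hi⟩ := this
    rw [Finset.prod_eq_zero (Finset.mem_univ i), smul_zero]
    exact hpos _ _ hi
  · simp

end Units

/-! ### Automorphisms fixing all `M_k` are inner. -/

section Kernel

/-- An automorphism that fixes the diagonal matrix units multiplies each entry by a scalar. -/
lemma exists_scalars_of_map_idem {φ : order R K α ≃ₐ[R] order R K α}
    (hφ : ∀ i, φ (idem R K α i) = idem R K α i) :
    ∃ C : Fin n → Fin n → R, ∀ (x : order R K α) (i j : Fin n),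
      (φ x : Matrix (Fin n) (Fin n) K) i j =
        algebraMap R K (C i j) * (x : Matrix (Fin n) (Fin n) K) i j := by
  obtain ⟨p, hp⟩ := IsDiscreteValuationRing.exists_irreducible R
  -- `b i j` generates the rank one `R`-module `e_i Λ e_j`, which `φ` maps to itself.
  let b : Fin n → Fin n → order R K α := fun i j => entry i j _ (uniformizer_pow_mem hp _)
  choose C hC using fun i j => (mem_primePow_iff hp).1 (entry_mem (φ (b i j)) i j)
  refine ⟨C, fun x i j => ?_⟩
  obtain ⟨r, hr⟩ := (mem_primePow_iff hp).1 (entry_mem x i j)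
  have h1 : idem R K α i * x * idem R K α j = r • b i j := by
    apply Subtype.ext
    rw [idem_mul_mul_idem, coe_entry, hr]
    change _ = r • Matrix.single i j _
    rw [Matrix.smul_single, Algebra.smul_def, mul_comm]
  have h2 := congrArg φ h1
  rw [map_mul, map_mul, hφ, hφ, idem_mul_mul_idem, map_smul] at h2
  have h3 := congrFun (congrFun (congrArg Subtype.val h2) i) j
  rw [entry_apply_same] at h3
  rw [h3]
  change r • (φ (b i j) : Matrix (Fin n) (Fin n) K) i j = _
  rw [hC, hr, Algebra.smul_def]
  ring

lemma mem_inner_of_map_idem {φ : order R K α ≃ₐ[R] order R K α}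
    (hφ : ∀ i, φ (idem R K α i) = idem R K α i) : φ ∈ inner R (order R K α) := by
  obtain ⟨p, hp⟩ := IsDiscreteValuationRing.exists_irreducible R
  obtain ⟨C, hC⟩ := exists_scalars_of_map_idem hφ
  have hinj := IsFractionRing.injective R K
  have hdiag : ∀ i, C i i = 1 := fun i => by
    have := hC 1 i i
    rw [map_one] at this
    apply hinj
    simpa using this.symm
  have hmul : ∀ i j k, C i j * C j k = C i k := fun i j k => by
    let x : order R K α := entry i j _ (uniformizer_pow_mem hp _)
    let y : order R K α := entry j k _ (uniformizer_pow_mem hp _)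
    have h := congrFun (congrFun (congrArg Subtype.val (map_mul φ x y)) i) k
    rw [hC, MulMemClass.coe_mul, MulMemClass.coe_mul, Matrix.mul_apply, Matrix.mul_apply,
      Finset.sum_eq_single j, Finset.sum_eq_single j] at h
    · rw [hC, hC] at h
      simp only [x, y, entry_apply_same] at h
      have h0 := uniformizer_ne_zero (K := K) hp
      apply hinj
      rw [map_mul]
      have h1 := pow_ne_zero (α.exp i j) h0
      have h2 := pow_ne_zero (α.exp j k) h0
      apply mul_right_cancel₀ (mul_ne_zero h1 h2)
      rw [h]
      ring
    · intro l _ hl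
      rw [hC]
      simp [x, coe_entry, Ne.symm hl]
    · simp
    · intro l _ hl
      simp [x, coe_entry, Ne.symm hl]
    · simp
  rcases isEmpty_or_nonempty (Fin n) with hn | ⟨⟨k⟩⟩
  · exact ⟨1, fun x => Subtype.ext (Matrix.ext fun i => isEmptyElim i)⟩
  have hmem : ∀ c : Fin n → R, Matrix.diagonal (fun i => algebraMap R K (c i)) ∈ order R K α := by
    intro c i j
    rw [Matrix.diagonal_apply]
    split_ifs with h
    · subst h
      rw [α.diag]
      exact algebraMap_mem_primePow_zero R K _
    · exact Submodule.zero_mem _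
  -- The cocycle `C i j = C i k * C k j` is split by a base index `k`: the unit is the diagonal
  -- matrix with entries `C i k`.
  refine ⟨⟨⟨_, hmem fun i => C i k⟩, ⟨_, hmem fun i => C k i⟩, ?_, ?_⟩, fun x => ?_⟩
  · apply Subtype.ext
    simp [← map_mul, hmul, hdiag]
  · apply Subtype.ext
    simp [← map_mul, hmul, hdiag]
  · apply Subtype.ext
    ext i j
    rw [hC, ← hmul i k j, map_mul]
    simp [Matrix.diagonal_mul, Matrix.mul_diagonal]
    ring

/-- An automorphism of a basic tiled order that fixes all ideals `M_k` is inner. -/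
lemma mem_inner_of_induces_one (hα : ∀ i j, i ≠ j → 0 < α.exp i j + α.exp j i)
    {φ : order R K α ≃ₐ[R] order R K α} (hφ : Induces φ 1) : φ ∈ inner R (order R K α) := by
  -- This `u` satisfies `φ(e_i) u = u e_i`. If `u ∈ M_k`, then `φ(e_k) e_k ∈ M_k`, though neither
  -- factor lies there because `φ` fixes `M_k`.
  let u : order R K α := ∑ i, φ (idem R K α i) * idem R K α i
  have hu_idem : ∀ i, u * idem R K α i = φ (idem R K α i) * idem R K α i := by
    intro i
    rw [Finset.sum_mul, Finset.sum_eq_single i, mul_assoc, idem_mul_idem_self]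
    · intro j _ hj
      rw [mul_assoc, idem_mul_idem hj, mul_zero]
    · simp
  have hidem_u : ∀ i, φ (idem R K α i) * u = φ (idem R K α i) * idem R K α i := by
    intro i
    rw [Finset.mul_sum, Finset.sum_eq_single i, ← mul_assoc, ← map_mul, idem_mul_idem_self]
    · intro j _ hj
      rw [← mul_assoc, ← map_mul, idem_mul_idem hj.symm, map_zero, zero_mul]
    · simp
  have hu : IsUnit u := by
    refine isUnit_of_notMem_maxIdeal hα u fun k hk => ?_
    have hP := isCompletelyPrime_maxIdeal (R := R) (K := K) hα k
    have h1 := hP.mul_right _ (idem R K α k) hk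
    rw [hu_idem] at h1
    rcases hP.mem_or_mem _ _ h1 with h | h
    · have h2 := hφ k
      rw [Equiv.Perm.one_apply] at h2
      rw [← h2, mem_map_algEquiv, AlgEquiv.symm_apply_apply] at h
      exact idem_mem_maxIdeal_iff.1 h rfl
    · exact idem_mem_maxIdeal_iff.1 h rfl
  obtain ⟨v, hv⟩ := hu
  have hinner := conjAlgEquiv_mem_inner (R := R) v
  rw [← (inner R (order R K α)).mul_mem_cancel_left ((inner R (order R K α)).inv_mem hinner)]
  refine mem_inner_of_map_idem fun i => ?_
  change (conjAlgEquiv (R := R) v).symm (φ (idem R K α i)) = _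
  rw [AlgEquiv.symm_apply_eq, conjAlgEquiv_apply, Units.eq_mul_inv_iff_mul_eq, hv, hidem_u,
    hu_idem]

end Kernel

/-! ### Monomial conjugations lifting link graph automorphisms. -/

section Twist

/-- The exponent of the uniformizer in the monomial matrix realizing a permutation. -/
def shift (α : ExponentMatrix n) (σ : Equiv.Perm (Fin n)) (i j : Fin n) : ℤ :=
  α.exp i j - α.exp (σ.symm i) (σ.symm j)

/-- The shift is the coboundary of `d ∘ σ.symm`, which makes `twist` multiplicative. Expressed
through `α`, it avoids the choice of `d`, so that `twist` is also multiplicative in `σ`. -/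
lemma shift_add {σ : Equiv.Perm (Fin n)}
    (hσ : ∃ d : Fin n → ℤ, ∀ i j, (α.exp (σ i) (σ j) : ℤ) = α.exp i j + d i - d j)
    (i j k : Fin n) : shift α σ i j + shift α σ j k = shift α σ i k := by
  obtain ⟨d, hd⟩ := hσ
  have h : ∀ i j, shift α σ i j = d (σ.symm i) - d (σ.symm j) := fun i j => by
    have := hd (σ.symm i) (σ.symm j)
    rw [Equiv.apply_symm_apply, Equiv.apply_symm_apply] at this
    rw [shift, this]
    ring
  rw [h, h, h]
  ring

/-- The endomorphism of `Λ` given by conjugation with the monomial matrix that realizes a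
permutation changing the exponents by a coboundary. -/
def twist {p : R} (hp : Irreducible p) (σ : Equiv.Perm (Fin n))
    (hσ : ∃ d : Fin n → ℤ, ∀ i j, (α.exp (σ i) (σ j) : ℤ) = α.exp i j + d i - d j) :
    order R K α →ₐ[R] order R K α :=
  AlgHom.ofLinearMap
    { toFun := fun x => ⟨Matrix.of fun i j => algebraMap R K p ^ shift α σ i j *
        (x : Matrix (Fin n) (Fin n) K) (σ.symm i) (σ.symm j), fun _ _ =>
          zpow_mul_mem_primePow hp (entry_mem x _ _)⟩
      map_add' := fun x y => by
        apply Subtype.ext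
        ext i j
        exact mul_add _ _ _
      map_smul' := fun r x => by
        apply Subtype.ext
        ext i j
        exact mul_smul_comm _ _ _ }
    (by
      apply Subtype.ext
      ext i j
      by_cases h : i = j
      · subst h
        simp [shift, α.diag]
      · simp [h])
    (fun x y => by
      apply Subtype.ext
      ext i k
      have h0 := uniformizer_ne_zero (K := K) hp
      simp only [LinearMap.coe_mk, AddHom.coe_mk, MulMemClass.coe_mul, Matrix.of_apply,
        Matrix.mul_apply, Finset.mul_sum]
      rw [← Equiv.sum_comp σ.symm]
      refine Finset.sum_congr rfl fun j _ => ?_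
      rw [← shift_add hσ i j k, zpow_add₀ h0]
      ring)

variable {p : R} (hp : Irreducible p)

lemma twist_apply (σ : Equiv.Perm (Fin n))
    (hσ : ∃ d : Fin n → ℤ, ∀ i j, (α.exp (σ i) (σ j) : ℤ) = α.exp i j + d i - d j)
    (x : order R K α) (i j : Fin n) :
    (twist hp σ hσ x : Matrix (Fin n) (Fin n) K) i j = algebraMap R K p ^ shift α σ i j *
      (x : Matrix (Fin n) (Fin n) K) (σ.symm i) (σ.symm j) := rfl

/-- The action of the automorphisms of the link graph by conjugation with monomial matrices. -/
noncomputable def linkGraphAutLift (h : ∀ σ : LinkGraphAut R K α, ∃ d : Fin n → ℤ,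
      ∀ i j, (α.exp (σ i) (σ j) : ℤ) = α.exp i j + d i - d j) :
    LinkGraphAut R K α →* (order R K α ≃ₐ[R] order R K α) :=
  -- A homomorphism from a group to the monoid of endomorphisms lands in its units, so invertibility
  -- of the twists is automatic.
  (AlgEquiv.algHomUnitsEquiv R (order R K α)).toMonoidHom.comp <| MonoidHom.toHomUnits
    { toFun := fun σ => twist hp σ.toEquiv (h σ)
      map_one' := by
        ext x i j
        rw [twist_apply]
        change algebraMap R K p ^ ((α.exp i j : ℤ) - α.exp i j) * _ = _
        rw [sub_self, zpow_zero, one_mul]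
        rfl
      map_mul' := fun σ τ => by
        ext x i j
        rw [AlgHom.mul_apply, twist_apply, twist_apply, twist_apply, ← mul_assoc,
          ← zpow_add₀ (uniformizer_ne_zero hp)]
        change algebraMap R K p ^ ((α.exp i j : ℤ) -
          α.exp (τ.symm (σ.symm i)) (τ.symm (σ.symm j))) * _ = algebraMap R K p ^
            ((α.exp i j : ℤ) - α.exp (σ.symm i) (σ.symm j) + (α.exp (σ.symm i) (σ.symm j) -
              α.exp (τ.symm (σ.symm i)) (τ.symm (σ.symm j)))) * _
        rw [sub_add_sub_cancel]
        rfl }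

lemma linkGraphAutLift_induces (hα : ∀ i j, i ≠ j → 0 < α.exp i j + α.exp j i)
    (h : ∀ σ : LinkGraphAut R K α, ∃ d : Fin n → ℤ,
      ∀ i j, (α.exp (σ i) (σ j) : ℤ) = α.exp i j + d i - d j) (σ : LinkGraphAut R K α) :
    Induces (linkGraphAutLift hp h σ) σ.toEquiv := by
  refine induces_of_mem hα fun i x hx => ?_
  change twist hp σ.toEquiv (h σ) x ∈ _
  rw [mem_maxIdeal, twist_apply, Equiv.symm_apply_apply]
  simpa [shift, α.diag] using mem_maxIdeal.1 hx

end Twist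

end TiledOrder

theorem theorem8 {R K : Type*} [CommRing R] [IsDomain R] [IsDiscreteValuationRing R]
    [IsAdicComplete (IsLocalRing.maximalIdeal R) R]
    [Field K] [Algebra R K] [IsFractionRing R K]
    {n : ℕ} (α : ExponentMatrix n)
    (hbasic : TiledOrder.IsBasic R K α)
    (h01 : ∀ i j, α.exp i j = 0 ∨ α.exp i j = 1) :
    (∀ σ : TiledOrder.LinkGraphAut R K α, TiledOrder.IsLiftable σ) ∧
    ∃ (θ : TiledOrder.LinkGraphAut R K α →*
          MulAut (TiledOrder.inner R (TiledOrder.order R K α)))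
      (e : TiledOrder.inner R (TiledOrder.order R K α) ⋊[θ] TiledOrder.LinkGraphAut R K α ≃*
          (TiledOrder.order R K α ≃ₐ[R] TiledOrder.order R K α)),
      (∀ u : TiledOrder.inner R (TiledOrder.order R K α),
        e (SemidirectProduct.inl u) = u) ∧
      (∀ σ : TiledOrder.LinkGraphAut R K α,
        TiledOrder.Induces (e (SemidirectProduct.inr σ)) σ.toEquiv) := by
  have hα : ∀ i j, i ≠ j → 0 < α.exp i j + α.exp j i := fun _ _ => hbasic.exp_add_exp_pos
  obtain ⟨p, hp⟩ := IsDiscreteValuationRing.exists_irreducible R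
  let s := TiledOrder.linkGraphAutLift (K := K) hp (TiledOrder.exists_potential hα h01)
  have hs : ∀ σ, TiledOrder.Induces (s σ) σ.toEquiv :=
    TiledOrder.linkGraphAutLift_induces hp hα _
  refine ⟨fun σ => ⟨s σ, hs σ⟩, ?_⟩
  obtain ⟨θ, e, hinl, hinr⟩ := exists_semidirectProduct_mulEquiv
    (TiledOrder.inner R (TiledOrder.order R K α)) s
    (fun σ hσ => RelIso.toEquiv_injective
      ((hs σ).unique (TiledOrder.induces_one_of_mem_inner hα hσ)))
    -- Dividing `φ` by the lift of its own permutation leaves an automorphism that fixes every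
    -- `M_k`.
    (fun φ => by
      obtain ⟨σ, hσ⟩ := TiledOrder.exists_induces hα φ
      refine ⟨⟨σ, hσ.adj_iff _ _⟩, TiledOrder.mem_inner_of_induces_one hα ?_⟩
      simpa using hσ.mul (hs ⟨σ, hσ.adj_iff _ _⟩).inv)
  exact ⟨θ, e, hinl, fun σ => hinr σ ▸ hs σ⟩
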